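/- Let $(X,\mathcal B)$ be a non-empty standard Borel space, $\sigma:X\to X$ a surjective Borel map, and $R$ a transfer operator for $\sigma$ on real Borel functions: a positive linear operator with $R((f\circ\sigma)g)=f\,R(g)$ that is order continuous (if $|f_n|\le h_n$ and $h_n\downarrow 0$ then $|R f_n|\le k_n$ eventually, for some Borel $k_n\downarrow 0$). Its domain is the space of all real Borel functions or, more generally, a linear space of Borel functions that contains the constants and every Borel function dominated in absolute value by one of its members; on a Borel function $f$ outside the domain put $R(f)(x)=\int f\,d\mu_x$, $\mu_x(A)=R(\chi_A)(x)$ (this formula also holds on the domain). Assume that $R$ is normalized, $R(\mathbf 1)=\mathbf 1$. For a measure $\nu$ let $(\nu R)(A)=\int_X R(\chi_A)\,d\nu$ and $(\nu\circ\sigma^{-1})(A)=\nu(\sigma^{-1}(A))$; let $M_1$ be the set of Borel probability measures on $X$ and $K_1=\{\nu R:\nu\in M_1\}$. Let $\mathcal H(X)$ be the universal Hilbert space: its elements are the classes $f\sqrt{d\mu}$ of pairs $(f,\mu)$ with $\mu$ a sigma-finite Borel measure and $f\in L^2(\mu)$ real, where $(f,\mu)\sim(g,\nu)$ iff $f\sqrt{d\mu/d\rho}=g\sqrt{d\nu/d\rho}$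 $\rho$-a.e. for some sigma-finite $\rho$ with $\mu,\nu\ll\rho$; the vector operations are $c\,(f\sqrt{d\mu})=(cf)\sqrt{d\mu}$ and $f\sqrt{d\mu}+g\sqrt{d\nu}=\big(f\sqrt{d\mu/d\rho}+g\sqrt{d\nu/d\rho}\big)\sqrt{d\rho}$, and the inner product is $\langle f\sqrt{d\mu},g\sqrt{d\nu}\rangle=\int fg\sqrt{d\mu/d\rho}\sqrt{d\nu/d\rho}\,d\rho$. Put $\mathcal H(\mu)=\{f\sqrt{d\mu}:f\in L^2(\mu)\}$, and let $\mathcal H_{K_1}$ be the closed linear span of the subspaces $\mathcal H(\mu)$, $\mu\in K_1$. Let $\widehat S(f\sqrt{d\mu})=(f\circ\sigma)\sqrt{d(\mu R)}$ on $\mathcal H(X)$. Every vector of $\mathcal H_{K_1}$ has the form $f\sqrt{d\mu}$ with $\mu\in K_1$, and $\widehat R$ is the operator on $\mathcal H(X)=\mathcal H_{K_1}\oplus\mathcal H_{K_1}^{\perp}$ given by $\widehat R(f\sqrt{d\mu}+u)=R(f)\sqrt{d(\mu\circ\sigma^{-1})}$ for $\mu\in K_1$, $f\in L^2(\mu)$,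 $u\in\mathcal H_{K_1}^{\perp}$; both operators are well defined. Then, for every Borel probability measure $\lambda$ on $X$, the following statements are equivalent: (1) $\lambda\in K_1$; (2) $(\lambda\circ\sigma^{-1})R=\lambda$; (3) for every $f\in L^2(\lambda)$ the function $R(f)\circ\sigma$ is defined $\lambda$-a.e. (that is, $f$ is $\mu_{\sigma(x)}$-integrable for $\lambda$-a.e. $x$) and equals the conditional expectation $\mathbb E_\lambda(f\mid\sigma^{-1}(\mathcal B))$ $\lambda$-a.e.; (4) the operator $\widehat E_1=\widehat S\widehat R$ maps $\mathcal H(\lambda)$ into itself, and $\widehat E_1(f\sqrt{d\lambda})=\mathbb E_\lambda(f\mid\sigma^{-1}(\mathcal B))\sqrt{d\lambda}$ for every $f\in L^2(\lambda)$. -/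

import Mathlib

open MeasureTheory ProbabilityTheory Filter Topology
open scoped ENNReal

/-- A pair `(f, μ)`: a sigma-finite Borel measure `μ` and a real Borel function `f ∈ L²(μ)`. -/
structure SqrtPair (X : Type*) [MeasurableSpace X] where
  measure : Measure X
  fn : X → ℝ
  sigmaFinite : SigmaFinite measure
  measurable_fn : Measurable fn
  memLp : MemLp fn 2 measure

namespace SqrtPair

variable {X : Type*} [MeasurableSpace X]

instance (p : SqrtPair X) : SigmaFinite p.measure := p.sigmaFinite

/-- The function `f √(dμ/dρ)` attached to a pair `(f, μ)` and a measure `ρ`. -/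
noncomputable def density (p : SqrtPair X) (ρ : Measure X) : X → ℝ :=
  fun x => p.fn x * Real.sqrt (p.measure.rnDeriv ρ x).toReal

/-- Equivalence of pairs: `f √(dμ/dρ) = g √(dν/dρ)` holds `ρ`-almost everywhere for some
sigma-finite `ρ` dominating both `μ` and `ν`. -/
def Equivalent (p q : SqrtPair X) : Prop :=
  ∃ ρ : Measure X, SigmaFinite ρ ∧ p.measure ≪ ρ ∧ q.measure ≪ ρ ∧
    p.density ρ =ᵐ[ρ] q.density ρ

lemma measurable_density (p : SqrtPair X) (ρ : Measure X) : Measurable (p.density ρ) :=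
  p.measurable_fn.mul
    (Real.continuous_sqrt.measurable.comp (Measure.measurable_rnDeriv _ _).ennreal_toReal)

lemma density_chain (p : SqrtPair X) {ρ τ : Measure X} [SigmaFinite ρ] [SigmaFinite τ]
    (h : p.measure ≪ ρ) :
    p.density τ =ᵐ[τ] fun x => p.density ρ x * Real.sqrt (ρ.rnDeriv τ x).toReal := by
  filter_upwards [Measure.rnDeriv_mul_rnDeriv (κ := τ) h] with x hx
  simp only [density]
  rw [← hx, Pi.mul_apply, ENNReal.toReal_mul, Real.sqrt_mul ENNReal.toReal_nonneg, mul_assoc]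

lemma ae_of_ae_rnDeriv {ρ τ : Measure X} {P : X → Prop} (h : ∀ᵐ x ∂ρ, P x) :
    ∀ᵐ x ∂τ, ρ.rnDeriv τ x ≠ 0 → P x := by
  rw [← ae_withDensity_iff (Measure.measurable_rnDeriv _ _)]
  exact (Measure.absolutelyContinuous_of_le (Measure.withDensity_rnDeriv_le ρ τ)).ae_le h

lemma density_eq_of_equivalent {p q : SqrtPair X} (h : p.Equivalent q) (τ : Measure X)
    [SigmaFinite τ] : p.density τ =ᵐ[τ] q.density τ := by
  obtain ⟨ρ, hρ, hp, hq, he⟩ := h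
  filter_upwards [p.density_chain (τ := τ) hp, q.density_chain (τ := τ) hq,
    ae_of_ae_rnDeriv (τ := τ) he] with x h1 h2 h3
  rw [h1, h2]
  by_cases h0 : ρ.rnDeriv τ x = 0
  · simp [h0]
  · rw [h3 h0]

lemma equivalent_iff {p q : SqrtPair X} : p.Equivalent q ↔
    ∀ τ : Measure X, SigmaFinite τ → p.density τ =ᵐ[τ] q.density τ := by
  refine ⟨fun h τ _ => density_eq_of_equivalent h τ, fun h => ?_⟩
  have : SigmaFinite (p.measure + q.measure) := inferInstance
  exact ⟨p.measure + q.measure, this, Measure.AbsolutelyContinuous.rfl.add_right _,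
    Measure.AbsolutelyContinuous.rfl.add_right' _, h _ this⟩

lemma density_self (p : SqrtPair X) : p.density p.measure =ᵐ[p.measure] p.fn := by
  filter_upwards [Measure.rnDeriv_self p.measure] with x hx
  simp [density, hx]

/-- If `p.measure = μ` and `q.measure = μ`, equivalence is equality `μ`-almost everywhere. -/
lemma equivalent_of_ae {μ : Measure X} {p q : SqrtPair X} (hp : p.measure = μ)
    (hq : q.measure = μ) (h : p.fn =ᵐ[μ] q.fn) : p.Equivalent q := by
  have : SigmaFinite μ := hp ▸ p.sigmaFinite
  refine ⟨μ, this, hp ▸ .rfl, hq ▸ .rfl, ?_⟩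
  filter_upwards [h] with x hx
  simp [density, hp, hq, hx]

lemma memLp_density (p : SqrtPair X) (ρ : Measure X) [SigmaFinite ρ] :
    MemLp (p.density ρ) 2 ρ := by
  refine (memLp_two_iff_integrable_sq (p.measurable_density ρ).aestronglyMeasurable).2 ?_
  have h1 := (memLp_two_iff_integrable_sq p.measurable_fn.aestronglyMeasurable).1 p.memLp
  have h2 : Integrable (fun x => p.fn x ^ 2) (ρ.withDensity (p.measure.rnDeriv ρ)) :=
    h1.mono_measure (Measure.withDensity_rnDeriv_le _ _)
  rw [integrable_withDensity_iff (Measure.measurable_rnDeriv _ _)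
    (Measure.rnDeriv_lt_top _ _)] at h2
  refine h2.congr (.of_forall fun x => ?_)
  simp only [density]
  rw [mul_pow, Real.sq_sqrt ENNReal.toReal_nonneg]

instance setoid (X : Type*) [MeasurableSpace X] : Setoid (SqrtPair X) where
  r := Equivalent
  iseqv :=
    { refl := fun _ => equivalent_iff.2 fun _ _ => .rfl
      symm := fun h => equivalent_iff.2 fun τ hτ => (equivalent_iff.1 h τ hτ).symm
      trans := fun h k => equivalent_iff.2 fun τ hτ =>
        (equivalent_iff.1 h τ hτ).trans (equivalent_iff.1 k τ hτ) }

/-- `f √dμ + g √dν = (f √(dμ/dρ) + g √(dν/dρ)) √dρ` with `ρ = μ + ν`. -/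
noncomputable def add (p q : SqrtPair X) : SqrtPair X where
  measure := p.measure + q.measure
  fn := fun x => p.density (p.measure + q.measure) x + q.density (p.measure + q.measure) x
  sigmaFinite := inferInstance
  measurable_fn := (p.measurable_density _).add (q.measurable_density _)
  memLp := (p.memLp_density _).add (q.memLp_density _)

/-- `c (f √dμ) = (c f) √dμ`. -/
noncomputable def smul (c : ℝ) (p : SqrtPair X) : SqrtPair X where
  measure := p.measure
  fn := fun x => c * p.fn x
  sigmaFinite := p.sigmaFinite
  measurable_fn := p.measurable_fn.const_mul c
  memLp := p.memLp.const_mul c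

/-- The zero vector. -/
noncomputable def zero : SqrtPair X where
  measure := 0
  fn := fun _ => 0
  sigmaFinite := inferInstance
  measurable_fn := measurable_const
  memLp := MemLp.zero'

lemma density_add (p q : SqrtPair X) (τ : Measure X) [SigmaFinite τ] :
    (add p q).density τ =ᵐ[τ] fun x => p.density τ x + q.density τ x := by
  filter_upwards [p.density_chain (ρ := p.measure + q.measure) (τ := τ)
      (Measure.AbsolutelyContinuous.rfl.add_right _),
    q.density_chain (ρ := p.measure + q.measure) (τ := τ)
      (Measure.AbsolutelyContinuous.rfl.add_right' _)] with x h1 h2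
  rw [h1, h2, ← add_mul]
  rfl

lemma density_smul (c : ℝ) (p : SqrtPair X) (τ : Measure X) (x : X) :
    (smul c p).density τ x = c * p.density τ x := by
  simp [density, smul, mul_assoc]

lemma density_zero (τ : Measure X) (x : X) : (zero : SqrtPair X).density τ x = 0 := by
  simp [density, zero]

/-- `⟨f √dμ, g √dν⟩ = ∫ f g √(dμ/dρ) √(dν/dρ) dρ` with `ρ = μ + ν`. -/
noncomputable def inner (p q : SqrtPair X) : ℝ :=
  ∫ x, p.density (p.measure + q.measure) x * q.density (p.measure + q.measure) x
    ∂(p.measure + q.measure)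

lemma integral_density_mul (p q : SqrtPair X) {ρ τ : Measure X} [SigmaFinite ρ] [SigmaFinite τ]
    (hp : p.measure ≪ ρ) (hq : q.measure ≪ ρ) (h : ρ ≪ τ) :
    ∫ x, p.density τ x * q.density τ x ∂τ = ∫ x, p.density ρ x * q.density ρ x ∂ρ := by
  rw [← integral_rnDeriv_smul h]
  refine integral_congr_ae ?_
  filter_upwards [p.density_chain (τ := τ) hp, q.density_chain (τ := τ) hq] with x h1 h2
  rw [h1, h2, smul_eq_mul, mul_mul_mul_comm, Real.mul_self_sqrt ENNReal.toReal_nonneg, mul_comm]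

/-- The inner product can be computed with any dominating measure. -/
lemma inner_eq (p q : SqrtPair X) {τ : Measure X} [SigmaFinite τ]
    (hp : p.measure ≪ τ) (hq : q.measure ≪ τ) :
    inner p q = ∫ x, p.density τ x * q.density τ x ∂τ := by
  refine (integral_density_mul p q (Measure.AbsolutelyContinuous.rfl.add_right _)
    (Measure.AbsolutelyContinuous.rfl.add_right' _) ?_).symm
  exact Measure.AbsolutelyContinuous.add_left hp hq

end SqrtPair

/-- The universal Hilbert space `ℋ(X)`: equivalence classes `f √dμ` of pairs `(f, μ)`. -/
def UniversalHilbert (X : Type*) [MeasurableSpace X] : Type _ := Quotient (SqrtPair.setoid X)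

namespace UniversalHilbert

variable {X : Type*} [MeasurableSpace X]

/-- The class `f √dμ` of the pair `(f, μ)`. -/
def mk (p : SqrtPair X) : UniversalHilbert X := Quotient.mk _ p

lemma mk_eq_iff {p q : SqrtPair X} : mk p = mk q ↔ p.Equivalent q := Quotient.eq

lemma mk_eq_iff_density {p q : SqrtPair X} : mk p = mk q ↔
    ∀ τ : Measure X, SigmaFinite τ → p.density τ =ᵐ[τ] q.density τ :=
  mk_eq_iff.trans SqrtPair.equivalent_iff

lemma exists_mk (v : UniversalHilbert X) : ∃ p, mk p = v := Quotient.exists_rep v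

noncomputable instance : Add (UniversalHilbert X) :=
  ⟨Quotient.map₂ SqrtPair.add fun p p' hp q q' hq => SqrtPair.equivalent_iff.2 fun τ hτ => by
    filter_upwards [SqrtPair.density_add p q τ, SqrtPair.density_add p' q' τ,
      SqrtPair.equivalent_iff.1 hp τ hτ, SqrtPair.equivalent_iff.1 hq τ hτ] with x h1 h2 h3 h4
    rw [h1, h2, h3, h4]⟩

noncomputable instance : SMul ℝ (UniversalHilbert X) :=
  ⟨fun c => Quotient.map (SqrtPair.smul c) fun p p' hp => SqrtPair.equivalent_iff.2 fun τ hτ => by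
    filter_upwards [SqrtPair.equivalent_iff.1 hp τ hτ] with x h
    rw [SqrtPair.density_smul, SqrtPair.density_smul, h]⟩

noncomputable instance : Zero (UniversalHilbert X) := ⟨mk SqrtPair.zero⟩

noncomputable instance : Neg (UniversalHilbert X) := ⟨fun v => (-1 : ℝ) • v⟩

lemma mk_add (p q : SqrtPair X) : mk p + mk q = mk (p.add q) := rfl

lemma smul_mk (c : ℝ) (p : SqrtPair X) : c • mk p = mk (p.smul c) := rfl

lemma zero_def : (0 : UniversalHilbert X) = mk SqrtPair.zero := rfl

lemma neg_def (v : UniversalHilbert X) : -v = (-1 : ℝ) • v := rfl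

noncomputable instance : AddCommGroup (UniversalHilbert X) :=
  { AddGroup.ofLeftAxioms
      (fun u v w => by
        obtain ⟨p, rfl⟩ := exists_mk u
        obtain ⟨q, rfl⟩ := exists_mk v
        obtain ⟨r, rfl⟩ := exists_mk w
        simp only [mk_add]
        refine mk_eq_iff_density.2 fun τ hτ => ?_
        filter_upwards [SqrtPair.density_add (p.add q) r τ, SqrtPair.density_add p q τ,
          SqrtPair.density_add p (q.add r) τ, SqrtPair.density_add q r τ] with x h1 h2 h3 h4
        rw [h1, h2, h3, h4, add_assoc])
      (fun u => by
        obtain ⟨p, rfl⟩ := exists_mk u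
        rw [zero_def, mk_add]
        refine mk_eq_iff_density.2 fun τ hτ => ?_
        filter_upwards [SqrtPair.density_add SqrtPair.zero p τ] with x h1
        rw [h1, SqrtPair.density_zero, zero_add])
      (fun u => by
        obtain ⟨p, rfl⟩ := exists_mk u
        rw [zero_def, neg_def, smul_mk, mk_add]
        refine mk_eq_iff_density.2 fun τ hτ => ?_
        filter_upwards [SqrtPair.density_add (p.smul (-1)) p τ] with x h1
        rw [h1, SqrtPair.density_zero, SqrtPair.density_smul]
        ring) with
    add_comm := fun u v => by
      obtain ⟨p, rfl⟩ := exists_mk u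
      obtain ⟨q, rfl⟩ := exists_mk v
      simp only [mk_add]
      refine mk_eq_iff_density.2 fun τ hτ => ?_
      filter_upwards [SqrtPair.density_add p q τ, SqrtPair.density_add q p τ] with x h1 h2
      rw [h1, h2, add_comm] }

noncomputable instance : Module ℝ (UniversalHilbert X) where
  one_smul u := by
    obtain ⟨p, rfl⟩ := exists_mk u
    rw [smul_mk]
    refine mk_eq_iff_density.2 fun τ hτ => .of_forall fun x => ?_
    rw [SqrtPair.density_smul, one_mul]
  mul_smul a b u := by
    obtain ⟨p, rfl⟩ := exists_mk u
    simp only [smul_mk]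
    refine mk_eq_iff_density.2 fun τ hτ => .of_forall fun x => ?_
    simp only [SqrtPair.density_smul, mul_assoc]
  smul_zero a := by
    rw [zero_def, smul_mk]
    refine mk_eq_iff_density.2 fun τ hτ => .of_forall fun x => ?_
    simp only [SqrtPair.density_smul, SqrtPair.density_zero, mul_zero]
  zero_smul u := by
    obtain ⟨p, rfl⟩ := exists_mk u
    rw [zero_def, smul_mk]
    refine mk_eq_iff_density.2 fun τ hτ => .of_forall fun x => ?_
    simp only [SqrtPair.density_smul, SqrtPair.density_zero, zero_mul]
  smul_add a u v := by
    obtain ⟨p, rfl⟩ := exists_mk u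
    obtain ⟨q, rfl⟩ := exists_mk v
    simp only [smul_mk, mk_add]
    refine mk_eq_iff_density.2 fun τ hτ => ?_
    filter_upwards [SqrtPair.density_add p q τ,
      SqrtPair.density_add (p.smul a) (q.smul a) τ] with x h1 h2
    rw [h2, SqrtPair.density_smul, SqrtPair.density_smul, SqrtPair.density_smul, h1, mul_add]
  add_smul a b u := by
    obtain ⟨p, rfl⟩ := exists_mk u
    simp only [smul_mk, mk_add]
    refine mk_eq_iff_density.2 fun τ hτ => ?_
    filter_upwards [SqrtPair.density_add (p.smul a) (p.smul b) τ] with x h2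
    rw [h2, SqrtPair.density_smul, SqrtPair.density_smul, SqrtPair.density_smul, add_mul]

lemma inner_wellDefined (p q p' q' : SqrtPair X) (hp : p.Equivalent p') (hq : q.Equivalent q') :
    p.inner q = p'.inner q' := by
  set τ := p.measure + q.measure + (p'.measure + q'.measure) with hτ
  have h1 : p.measure + q.measure ≪ τ := Measure.AbsolutelyContinuous.rfl.add_right _
  have h2 : p'.measure + q'.measure ≪ τ := Measure.AbsolutelyContinuous.rfl.add_right' _
  rw [p.inner_eq q ((Measure.AbsolutelyContinuous.rfl.add_right _).trans h1)
      ((Measure.AbsolutelyContinuous.rfl.add_right' _).trans h1),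
    p'.inner_eq q' ((Measure.AbsolutelyContinuous.rfl.add_right _).trans h2)
      ((Measure.AbsolutelyContinuous.rfl.add_right' _).trans h2)]
  refine integral_congr_ae ?_
  filter_upwards [SqrtPair.density_eq_of_equivalent hp τ,
    SqrtPair.density_eq_of_equivalent hq τ] with x h3 h4
  rw [h3, h4]

/-- The inner product of `ℋ(X)`. -/
noncomputable def innerFun : UniversalHilbert X → UniversalHilbert X → ℝ :=
  Quotient.lift₂ SqrtPair.inner inner_wellDefined

lemma innerFun_mk (p q : SqrtPair X) : innerFun (mk p) (mk q) = p.inner q := rfl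

@[reducible] noncomputable def core : InnerProductSpace.Core ℝ (UniversalHilbert X) where
  inner := innerFun
  conj_inner_symm u v := by
    obtain ⟨p, rfl⟩ := exists_mk u
    obtain ⟨q, rfl⟩ := exists_mk v
    rw [innerFun_mk, innerFun_mk, p.inner_eq q (τ := q.measure + p.measure)
      (Measure.AbsolutelyContinuous.rfl.add_right' _)
      (Measure.AbsolutelyContinuous.rfl.add_right _)]
    simp only [SqrtPair.inner, conj_trivial, mul_comm]
  re_inner_nonneg u := by
    obtain ⟨p, rfl⟩ := exists_mk u
    exact integral_nonneg fun x => mul_self_nonneg _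
  add_left u v w := by
    obtain ⟨p, rfl⟩ := exists_mk u
    obtain ⟨q, rfl⟩ := exists_mk v
    obtain ⟨r, rfl⟩ := exists_mk w
    set τ := p.measure + q.measure + r.measure with hτ
    have h : p.measure + q.measure ≪ τ := Measure.AbsolutelyContinuous.rfl.add_right _
    have hp : p.measure ≪ τ := (Measure.AbsolutelyContinuous.rfl.add_right _).trans h
    have hq : q.measure ≪ τ := (Measure.AbsolutelyContinuous.rfl.add_right' _).trans h
    have hr : r.measure ≪ τ := Measure.AbsolutelyContinuous.rfl.add_right' _
    rw [mk_add, innerFun_mk, innerFun_mk, innerFun_mk, (p.add q).inner_eq r h hr, p.inner_eq r hp hr,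
      q.inner_eq r hq hr, ← integral_add]
    · refine integral_congr_ae ?_
      filter_upwards [SqrtPair.density_add p q τ] with x hx
      rw [hx, add_mul]
    · exact (p.memLp_density τ).integrable_mul (r.memLp_density τ)
    · exact (q.memLp_density τ).integrable_mul (r.memLp_density τ)
  smul_left u v c := by
    obtain ⟨p, rfl⟩ := exists_mk u
    obtain ⟨q, rfl⟩ := exists_mk v
    rw [smul_mk, innerFun_mk, innerFun_mk]
    simp only [SqrtPair.inner, SqrtPair.density_smul, conj_trivial, mul_assoc]
    rw [integral_const_mul]
    rfl
  definite u h := by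
    obtain ⟨p, rfl⟩ := exists_mk u
    rw [innerFun_mk, p.inner_eq p (τ := p.measure) .rfl .rfl, integral_eq_zero_iff_of_nonneg
      (fun x => mul_self_nonneg _)
      ((p.memLp_density _).integrable_mul (p.memLp_density _))] at h
    rw [zero_def, mk_eq_iff]
    refine ⟨p.measure, p.sigmaFinite, .rfl, Measure.AbsolutelyContinuous.zero _, ?_⟩
    filter_upwards [h] with x hx
    rw [SqrtPair.density_zero]
    simpa using hx

noncomputable instance : NormedAddCommGroup (UniversalHilbert X) := core.toNormedAddCommGroup

noncomputable instance : InnerProductSpace ℝ (UniversalHilbert X) :=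
  InnerProductSpace.ofCore core.toCore

lemma inner_mk (p q : SqrtPair X) : inner ℝ (mk p) (mk q) = p.inner q := rfl

/-- The vector `f √dμ`. -/
def vec (μ : Measure X) [SigmaFinite μ] (f : X → ℝ) (hf : Measurable f) (h2 : MemLp f 2 μ) :
    UniversalHilbert X :=
  mk ⟨μ, f, inferInstance, hf, h2⟩

lemma vec_congr {μ : Measure X} [SigmaFinite μ] {f g : X → ℝ} {hf : Measurable f}
    {hf2 : MemLp f 2 μ} {hg : Measurable g} {hg2 : MemLp g 2 μ} (h : f =ᵐ[μ] g) :
    vec μ f hf hf2 = vec μ g hg hg2 :=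
  mk_eq_iff.2 (SqrtPair.equivalent_of_ae rfl rfl h)

lemma exists_vec (v : UniversalHilbert X) : ∃ (μ : Measure X) (_ : SigmaFinite μ) (f : X → ℝ)
    (hf : Measurable f) (h2 : MemLp f 2 μ), v = vec μ f hf h2 := by
  obtain ⟨p, rfl⟩ := exists_mk v
  exact ⟨p.measure, p.sigmaFinite, p.fn, p.measurable_fn, p.memLp, rfl⟩

lemma vec_add {μ : Measure X} [SigmaFinite μ] {f g : X → ℝ} (hf : Measurable f)
    (hf2 : MemLp f 2 μ) (hg : Measurable g) (hg2 : MemLp g 2 μ) :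
    vec μ f hf hf2 + vec μ g hg hg2 = vec μ (f + g) (hf.add hg) (hf2.add hg2) := by
  unfold vec
  rw [mk_add, mk_eq_iff_density]
  intro τ hτ
  filter_upwards [SqrtPair.density_add ⟨μ, f, inferInstance, hf, hf2⟩
    ⟨μ, g, inferInstance, hg, hg2⟩ τ] with x hx
  rw [hx]
  simp [SqrtPair.density, add_mul]

lemma inner_vec {μ : Measure X} [SigmaFinite μ] {f g : X → ℝ} (hf : Measurable f)
    (hf2 : MemLp f 2 μ) (hg : Measurable g) (hg2 : MemLp g 2 μ) :
    inner ℝ (vec μ f hf hf2) (vec μ g hg hg2) = ∫ x, f x * g x ∂μ := by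
  unfold vec
  rw [inner_mk, SqrtPair.inner_eq (τ := μ) _ _ .rfl .rfl]
  refine integral_congr_ae ?_
  filter_upwards [SqrtPair.density_self ⟨μ, f, inferInstance, hf, hf2⟩,
    SqrtPair.density_self ⟨μ, g, inferInstance, hg, hg2⟩] with x h1 h2
  rw [h1, h2]

/-- The isometric embedding `ι : f ↦ f √dμ` of `L²(μ)` into `ℋ(X)`. -/
noncomputable def iota (μ : Measure X) [SigmaFinite μ] : Lp ℝ 2 μ →ₗᵢ[ℝ] UniversalHilbert X where
  toFun f := vec μ f (Lp.stronglyMeasurable f).measurable (Lp.memLp f)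
  map_add' f g := by
    rw [vec_add]
    exact vec_congr (Lp.coeFn_add f g)
  map_smul' c f := by
    simp only [RingHom.id_apply]
    unfold vec
    rw [smul_mk, mk_eq_iff]
    exact SqrtPair.equivalent_of_ae rfl rfl (Lp.coeFn_smul c f)
  norm_map' f := by
    rw [← sq_eq_sq₀ (norm_nonneg _) (norm_nonneg _), ← real_inner_self_eq_norm_sq,
      ← real_inner_self_eq_norm_sq]
    change inner ℝ (vec μ f _ _) (vec μ f _ _) = _
    rw [inner_vec, L2.inner_def]
    rfl

/-- The subspace `ℋ(μ) = {f √dμ : f ∈ L²(μ)}` of `ℋ(X)`. -/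
noncomputable def subspace (μ : Measure X) [SigmaFinite μ] : Submodule ℝ (UniversalHilbert X) :=
  LinearMap.range (iota μ).toLinearMap

lemma vec_mem_subspace (μ : Measure X) [SigmaFinite μ] {f : X → ℝ} (hf : Measurable f)
    (h2 : MemLp f 2 μ) : vec μ f hf h2 ∈ subspace μ :=
  ⟨h2.toLp f, vec_congr h2.coeFn_toLp⟩

lemma mem_subspace_iff {μ : Measure X} [SigmaFinite μ] {v : UniversalHilbert X} :
    v ∈ subspace μ ↔ ∃ (f : X → ℝ) (hf : Measurable f) (h2 : MemLp f 2 μ), v = vec μ f hf h2 := by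
  constructor
  · rintro ⟨f, rfl⟩
    exact ⟨f, _, _, rfl⟩
  · rintro ⟨f, hf, h2, rfl⟩
    exact vec_mem_subspace μ hf h2

lemma subspace_mono {μ ν : Measure X} [SigmaFinite μ] [SigmaFinite ν] (h : μ ≪ ν) :
    subspace μ ≤ subspace ν := by
  intro v hv
  obtain ⟨f, hf, h2, rfl⟩ := mem_subspace_iff.1 hv
  let p : SqrtPair X := ⟨μ, f, inferInstance, hf, h2⟩
  refine mem_subspace_iff.2 ⟨p.density ν, p.measurable_density ν, p.memLp_density ν, ?_⟩
  refine mk_eq_iff.2 ⟨ν, inferInstance, h, .rfl, ?_⟩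
  filter_upwards [SqrtPair.density_self
    ⟨ν, p.density ν, inferInstance, p.measurable_density ν, p.memLp_density ν⟩] with x hx
  exact hx.symm

lemma isComplete_subspace (μ : Measure X) [SigmaFinite μ] :
    IsComplete (subspace μ : Set (UniversalHilbert X)) := by
  have := (iota μ).isometry.isUniformInducing.isComplete_range
  exact this

instance : CompleteSpace (UniversalHilbert X) := by
  refine Metric.complete_of_cauchySeq_tendsto fun u hu => ?_
  choose μ hμ f hf h2 hv using fun n => exists_vec (u n)
  have hle : ∀ n, μ n ≪ (Measure.sum μ).toFinite := fun n =>
    (Measure.le_sum μ n).absolutelyContinuous.trans (absolutelyContinuous_toFinite _)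
  have hm : ∀ n, u n ∈ (subspace (Measure.sum μ).toFinite : Set (UniversalHilbert X)) := fun n =>
    subspace_mono (hle n) (by rw [hv n]; exact vec_mem_subspace _ _ _)
  obtain ⟨v, -, hv⟩ := cauchySeq_tendsto_of_isComplete (isComplete_subspace _) hm hu
  exact ⟨v, hv⟩

end UniversalHilbert

/-- Order convergence to `0` of a sequence of functions, with dominating functions in `D`:
`|f n| ≤ h n` eventually, for some sequence `h n ∈ D` with `h n ↓ 0`. -/
def OrderTendstoZero {X : Type*} (D : Set (X → ℝ)) (f : ℕ → X → ℝ) : Prop :=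
  ∃ h : ℕ → X → ℝ, (∀ n, h n ∈ D) ∧ Antitone h ∧ (∀ x, Tendsto (fun n => h n x) atTop (𝓝 0)) ∧
    ∃ N, ∀ n, N ≤ n → ∀ x, |f n x| ≤ h n x

/-- A transfer operator `(R, σ)` on Borel functions: `σ` is a surjective Borel endomorphism of
`X`, and `R = op` is a positive, order continuous linear operator satisfying the pull-out property
`R((f ∘ σ) g) = f R(g)`. The operator acts on a space `domain` of real Borel functions that contains
the constants and is closed under domination. The space of all Borel functions is a possible
domain; smaller domains accommodate operators such as `f ↦ ∫ f dμ_x`, where `μ_x` is a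
system of conditional measures, that do not make sense for every unbounded Borel function. -/
structure TransferOperator (X : Type*) [MeasurableSpace X] where
  σ : X → X
  measurable_σ : Measurable σ
  surjective_σ : Function.Surjective σ
  domain : Submodule ℝ (X → ℝ)
  measurable_of_mem : ∀ f ∈ domain, Measurable f
  one_mem : (fun _ => 1) ∈ domain
  solid : ∀ f g : X → ℝ, Measurable f → g ∈ domain → (∀ x, |f x| ≤ |g x|) → f ∈ domain
  op : domain →ₗ[ℝ] (X → ℝ)
  measurable_op : ∀ g : domain, Measurable (op g)
  op_nonneg : ∀ g : domain, (∀ x, 0 ≤ g.1 x) → ∀ x, 0 ≤ op g x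
  pull_out : ∀ (f : X → ℝ) (g : domain), Measurable f →
    ∀ h : (fun x => f (σ x) * g.1 x) ∈ domain, ∀ x, op ⟨_, h⟩ x = f x * op g x
  order_continuous : ∀ f : ℕ → domain, OrderTendstoZero (domain : Set (X → ℝ)) (fun n => (f n).1) →
    OrderTendstoZero {g : X → ℝ | Measurable g} (fun n => op (f n))

namespace TransferOperator

variable {X : Type*} [MeasurableSpace X] (R : TransferOperator X)

/-- `R` is normalized if `R(𝟏) = 𝟏`. -/
def Normalized : Prop := ∀ x, R.op ⟨fun _ => 1, R.one_mem⟩ x = 1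

lemma indicator_mem {A : Set X} (hA : MeasurableSet A) :
    A.indicator (fun _ => (1 : ℝ)) ∈ R.domain := by
  refine R.solid _ _ (measurable_const.indicator hA) R.one_mem fun x => ?_
  by_cases h : x ∈ A <;> simp [h]

lemma op_congr {f g : X → ℝ} (h : f = g) (hf : f ∈ R.domain) (hg : g ∈ R.domain) :
    R.op ⟨f, hf⟩ = R.op ⟨g, hg⟩ := by subst h; rfl

/-- `R(χ_A)`. -/
noncomputable def opInd (A : Set X) (hA : MeasurableSet A) : X → ℝ :=
  R.op ⟨_, R.indicator_mem hA⟩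

lemma opInd_nonneg {A : Set X} (hA : MeasurableSet A) (x : X) : 0 ≤ R.opInd A hA x :=
  R.op_nonneg _ (fun _ => Set.indicator_nonneg (fun _ _ => zero_le_one) _) x

lemma tendsto_op {f : ℕ → R.domain} (hanti : Antitone fun n => (f n).1)
    (h0 : ∀ x, Tendsto (fun n => (f n).1 x) atTop (𝓝 0)) (x : X) :
    Tendsto (fun n => R.op (f n) x) atTop (𝓝 0) := by
  have hnn : ∀ n y, 0 ≤ (f n).1 y := fun n y =>
    Antitone.le_of_tendsto (fun a b hab => hanti hab y) (h0 y) n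
  obtain ⟨h, -, -, ht, N, hN⟩ := R.order_continuous f
    ⟨fun n => (f n).1, fun n => (f n).2, hanti, h0, 0, fun n _ y => (abs_of_nonneg (hnn n y)).le⟩
  refine squeeze_zero_norm' ?_ (ht x)
  filter_upwards [eventually_ge_atTop N] with n hn using hN n hn x

lemma opInd_union {A B : Set X} (hA : MeasurableSet A) (hB : MeasurableSet B)
    (hAB : Disjoint A B) (x : X) :
    R.opInd (A ∪ B) (hA.union hB) x = R.opInd A hA x + R.opInd B hB x := by
  unfold opInd
  rw [← Pi.add_apply, ← map_add]
  exact congrFun (R.op_congr (Set.indicator_union_of_disjoint hAB _) _ _) x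

lemma opInd_congr {A B : Set X} (h : A = B) (hA : MeasurableSet A) (hB : MeasurableSet B) :
    R.opInd A hA = R.opInd B hB := by subst h; rfl

lemma opInd_empty (x : X) : R.opInd ∅ .empty x = 0 := by
  have := R.opInd_union .empty .empty (Set.disjoint_empty ∅) x
  rw [R.opInd_congr (Set.empty_union ∅) _ .empty] at this
  linarith

lemma opInd_iUnion ⦃A : ℕ → Set X⦄ (hA : ∀ i, MeasurableSet (A i))
    (hd : Pairwise (Function.onFun Disjoint A)) (x : X) :
    HasSum (fun i => R.opInd (A i) (hA i) x) (R.opInd (⋃ i, A i) (.iUnion hA) x) := by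
  have hT : ∀ n, MeasurableSet (⋃ i, A (i + n)) := fun n => .iUnion fun i => hA _
  have hsplit : ∀ n, (⋃ i, A (i + n)) = A n ∪ ⋃ i, A (i + (n + 1)) := by
    intro n
    ext y
    simp only [Set.mem_iUnion, Set.mem_union]
    constructor
    · rintro ⟨i, hi⟩
      rcases i with _ | i
      · left; simpa using hi
      · right; exact ⟨i, by convert hi using 2; ring⟩
    · rintro (h | ⟨i, hi⟩)
      · exact ⟨0, by simpa using h⟩
      · exact ⟨i + 1, by convert hi using 2; ring⟩
  have hdisj : ∀ n, Disjoint (A n) (⋃ i, A (i + (n + 1))) := fun n =>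
    Set.disjoint_iUnion_right.2 fun i => hd (by omega)
  have hsum : ∀ n, R.opInd (⋃ i, A i) (.iUnion hA) x =
      ∑ i ∈ Finset.range n, R.opInd (A i) (hA i) x + R.opInd (⋃ i, A (i + n)) (hT n) x := by
    intro n
    induction n with
    | zero => simp
    | succ n ih =>
      rw [ih, Finset.sum_range_succ, add_assoc, ← R.opInd_union _ _ (hdisj n)]
      rw [R.opInd_congr (hsplit n)]
  have hanti : Antitone fun n => (⋃ i, A (i + n)) := antitone_nat_of_succ_le fun n => by
    rw [hsplit n]; exact Set.subset_union_right
  have hlim : Tendsto (fun n => R.opInd (⋃ i, A (i + n)) (hT n) x) atTop (𝓝 0) := by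
    refine R.tendsto_op (f := fun n => ⟨_, R.indicator_mem (hT n)⟩) ?_ ?_ x
    · intro m n hmn y
      exact Set.indicator_le_indicator_of_subset (hanti hmn) (fun _ => zero_le_one) y
    · intro y
      refine tendsto_const_nhds.congr' ?_
      by_cases hy : ∃ j, y ∈ A j
      · obtain ⟨j, hj⟩ := hy
        filter_upwards [eventually_gt_atTop j] with n hn
        rw [Set.indicator_of_notMem]
        simp only [Set.mem_iUnion, not_exists]
        exact fun i hi => Set.disjoint_left.1 (hd (show j ≠ i + n by omega)) hj hi
      · push Not at hy
        refine .of_forall fun n => ?_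
        dsimp only
        rw [Set.indicator_of_notMem]
        simp [hy]
  rw [hasSum_iff_tendsto_nat_of_nonneg fun i => R.opInd_nonneg (hA i) x]
  have : (fun n => ∑ i ∈ Finset.range n, R.opInd (A i) (hA i) x) = fun n =>
      R.opInd (⋃ i, A i) (.iUnion hA) x - R.opInd (⋃ i, A (i + n)) (hT n) x := by
    funext n
    rw [hsum n]; ring
  rw [this]
  simpa using hlim.const_sub (R.opInd (⋃ i, A i) (.iUnion hA) x)

/-- The measure `A ↦ R(χ_A)(x)`. -/
noncomputable def fiber (x : X) : Measure X :=
  Measure.ofMeasurable (fun A hA => ENNReal.ofReal (R.opInd A hA x))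
    (by simp [R.opInd_empty]) (fun A hA hd => by
      have h := R.opInd_iUnion hA hd x
      rw [← h.tsum_eq, ENNReal.ofReal_tsum_of_nonneg (fun i => R.opInd_nonneg (hA i) x)
        h.summable])

lemma fiber_apply (x : X) {A : Set X} (hA : MeasurableSet A) :
    R.fiber x A = ENNReal.ofReal (R.opInd A hA x) := Measure.ofMeasurable_apply _ hA

/-- The family of measures `A ↦ R(χ_A)(x)`, measurable in `x`. -/
noncomputable def kernel : Kernel X X where
  toFun := R.fiber
  measurable' := Measure.measurable_of_measurable_coe _ fun A hA => by
    simp only [R.fiber_apply _ hA]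
    exact (R.measurable_op _).ennreal_ofReal

lemma kernel_apply (x : X) {A : Set X} (hA : MeasurableSet A) :
    R.kernel x A = ENNReal.ofReal (R.opInd A hA x) := R.fiber_apply x hA

/-- The action `μ ↦ μR` on measures: `(μR)(A) = ∫ R(χ_A) dμ`, see `act_apply`. -/
noncomputable def act (μ : Measure X) : Measure X := μ.bind R.kernel

lemma act_apply (μ : Measure X) {A : Set X} (hA : MeasurableSet A) :
    R.act μ A = ∫⁻ x, ENNReal.ofReal (R.op ⟨_, R.indicator_mem hA⟩ x) ∂μ := by
  rw [act, Measure.bind_apply hA R.kernel.aemeasurable]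
  simp only [R.kernel_apply _ hA]
  rfl

instance (x : X) : IsFiniteMeasure (R.kernel x) :=
  ⟨by rw [R.kernel_apply x .univ]; exact ENNReal.ofReal_lt_top⟩

/-- The set `K₁ = M₁(X) R` of the measures `νR`, where `ν` is a Borel probability measure. -/
def K₁ : Set (Measure X) := {μ | ∃ ν : Measure X, IsProbabilityMeasure ν ∧ μ = R.act ν}

open Classical in
/-- The function `R(f)`. For Borel functions outside the domain of `R`, the operator is extended by
`R(f)(x) = ∫ f dμ_x` with `μ_x(A) = R(χ_A)(x)`; this formula is also valid on the
domain, see `apply_eq_integral`. -/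
noncomputable def apply (f : X → ℝ) (x : X) : ℝ :=
  if h : f ∈ R.domain then R.op ⟨f, h⟩ x else ∫ y, f y ∂(R.kernel x)

lemma op_simple (s : SimpleFunc X ℝ) (hs : (s : X → ℝ) ∈ R.domain) (x : X) :
    R.op ⟨s, hs⟩ x = ∫ y, s y ∂(R.kernel x) := by
  have key : ∀ s : SimpleFunc X ℝ, ∃ h : (s : X → ℝ) ∈ R.domain,
      R.op ⟨s, h⟩ x = ∫ y, s y ∂(R.kernel x) := by
    intro s
    induction s using SimpleFunc.induction with
    | const c hA =>
      rename_i A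
      have he : ((SimpleFunc.piecewise A hA (SimpleFunc.const X c) (SimpleFunc.const X 0) :
          SimpleFunc X ℝ) : X → ℝ) = c • A.indicator (fun _ => (1 : ℝ)) := by
        ext y
        by_cases hy : y ∈ A <;> simp [hy]
      refine ⟨he ▸ R.domain.smul_mem c (R.indicator_mem hA), ?_⟩
      have h2 : R.op ⟨_, he ▸ R.domain.smul_mem c (R.indicator_mem hA)⟩ =
          c • R.op ⟨_, R.indicator_mem hA⟩ := by
        rw [← map_smul]
        congr 1
        exact Subtype.ext he
      rw [h2, he]
      simp only [Pi.smul_apply, smul_eq_mul]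
      rw [integral_const_mul, integral_indicator_const _ hA, Measure.real, R.kernel_apply x hA,
        ENNReal.toReal_ofReal (R.opInd_nonneg hA x)]
      simp [opInd]
    | add hd hf hg =>
      rename_i f g
      obtain ⟨h1, e1⟩ := hf
      obtain ⟨h2, e2⟩ := hg
      refine ⟨R.domain.add_mem h1 h2, ?_⟩
      have h3 : R.op ⟨(f + g : SimpleFunc X ℝ), R.domain.add_mem h1 h2⟩ =
          R.op ⟨f, h1⟩ + R.op ⟨g, h2⟩ := by
        rw [← map_add]
        rfl
      rw [h3, Pi.add_apply, e1, e2, ← integral_add (SimpleFunc.integrable_of_isFiniteMeasure f)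
        (SimpleFunc.integrable_of_isFiniteMeasure g)]
      rfl
  exact (key s).2

lemma op_eq_integral_of_nonneg (f : R.domain) (hf : ∀ y, 0 ≤ f.1 y) (x : X) :
    Integrable f.1 (R.kernel x) ∧ R.op f x = ∫ y, f.1 y ∂(R.kernel x) := by
  have hm := R.measurable_of_mem _ f.2
  let s : ℕ → SimpleFunc X ℝ := fun n =>
    (SimpleFunc.eapprox (fun y => ENNReal.ofReal (f.1 y)) n).map ENNReal.toReal
  have hle : ∀ n y, SimpleFunc.eapprox (fun y => ENNReal.ofReal (f.1 y)) n y ≤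
      ENNReal.ofReal (f.1 y) := fun n y => by
    rw [← SimpleFunc.iSup_eapprox_apply hm.ennreal_ofReal y]
    exact le_iSup (fun n => SimpleFunc.eapprox (fun y => ENNReal.ofReal (f.1 y)) n y) n
  have hs0 : ∀ n y, 0 ≤ s n y := fun n y => ENNReal.toReal_nonneg
  have hsf : ∀ n y, s n y ≤ f.1 y := fun n y => by
    have := ENNReal.toReal_mono ENNReal.ofReal_ne_top (hle n y)
    rwa [ENNReal.toReal_ofReal (hf y)] at this
  have hsm : ∀ y, Monotone fun n => s n y := fun y m n hmn =>
    ENNReal.toReal_mono (ne_top_of_le_ne_top ENNReal.ofReal_ne_top (hle n y))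
      (SimpleFunc.monotone_eapprox _ hmn y)
  have hst : ∀ y, Tendsto (fun n => s n y) atTop (𝓝 (f.1 y)) := fun y => by
    have := (ENNReal.tendsto_toReal ENNReal.ofReal_ne_top).comp
      (SimpleFunc.tendsto_eapprox hm.ennreal_ofReal y)
    rwa [ENNReal.toReal_ofReal (hf y)] at this
  have hsd : ∀ n, (s n : X → ℝ) ∈ R.domain := fun n =>
    R.solid _ _ (s n).measurable f.2 fun y => by
      rw [abs_of_nonneg (hs0 n y), abs_of_nonneg (hf y)]; exact hsf n y
  have hlim : Tendsto (fun n => R.op ⟨s n, hsd n⟩ x) atTop (𝓝 (R.op f x)) := by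
    have h0 := R.tendsto_op (f := fun n => f - ⟨s n, hsd n⟩)
      (fun m n hmn y => sub_le_sub_left (hsm y hmn) _)
      (fun y => by simpa using (hst y).const_sub (f.1 y)) x
    simp only [map_sub, Pi.sub_apply] at h0
    simpa using h0.const_sub (R.op f x)
  have hmono : ∀ n, R.op ⟨s n, hsd n⟩ x ≤ R.op f x := fun n => by
    have := R.op_nonneg (f - ⟨s n, hsd n⟩) (fun y => sub_nonneg.2 (hsf n y)) x
    rw [map_sub, Pi.sub_apply] at this
    linarith
  have hint : Integrable f.1 (R.kernel x) := by
    refine ⟨hm.aestronglyMeasurable, ?_⟩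
    rw [hasFiniteIntegral_iff_ofReal (.of_forall hf)]
    refine lt_of_le_of_lt ?_ (ENNReal.ofReal_lt_top (r := R.op f x))
    refine le_of_tendsto' (lintegral_tendsto_of_tendsto_of_monotone
      (f := fun n y => ENNReal.ofReal (s n y))
      (fun n => (s n).measurable.ennreal_ofReal.aemeasurable)
      (.of_forall fun y m n hmn => ENNReal.ofReal_le_ofReal (hsm y hmn))
      (.of_forall fun y => ENNReal.tendsto_ofReal (hst y))) fun n => ?_
    rw [← ofReal_integral_eq_lintegral_ofReal (SimpleFunc.integrable_of_isFiniteMeasure (s n))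
      (.of_forall (hs0 n)), ← R.op_simple (s n) (hsd n)]
    exact ENNReal.ofReal_le_ofReal (hmono n)
  refine ⟨hint, tendsto_nhds_unique hlim ?_⟩
  simp only [R.op_simple]
  refine tendsto_integral_of_dominated_convergence f.1
    (fun n => (s n).measurable.aestronglyMeasurable) hint
    (fun n => .of_forall fun y => ?_) (.of_forall hst)
  rw [Real.norm_of_nonneg (hs0 n y)]
  exact hsf n y

/-- On its domain, the operator `R` is given by integration against `A ↦ R(χ_A)(x)`. -/
lemma op_eq_integral (f : R.domain) (x : X) :
    Integrable f.1 (R.kernel x) ∧ R.op f x = ∫ y, f.1 y ∂(R.kernel x) := by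
  have hm := R.measurable_of_mem _ f.2
  have hp : (fun y => max (f.1 y) 0) ∈ R.domain :=
    R.solid _ _ (hm.max measurable_const) f.2 fun y => by
      rw [abs_of_nonneg (le_max_right _ _)]; exact max_le (le_abs_self _) (abs_nonneg _)
  have hn : (fun y => max (-f.1 y) 0) ∈ R.domain :=
    R.solid _ _ (hm.neg.max measurable_const) f.2 fun y => by
      rw [abs_of_nonneg (le_max_right _ _)]; exact max_le (neg_le_abs _) (abs_nonneg _)
  have he : f = ⟨_, hp⟩ - ⟨_, hn⟩ := by
    ext y
    change f.1 y = max (f.1 y) 0 - max (-f.1 y) 0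
    rcases le_total (f.1 y) 0 with h | h
    · rw [max_eq_right h, max_eq_left (by linarith)]; ring
    · rw [max_eq_left h, max_eq_right (by linarith)]; ring
  obtain ⟨i1, e1⟩ := R.op_eq_integral_of_nonneg ⟨_, hp⟩ (fun y => le_max_right _ _) x
  obtain ⟨i2, e2⟩ := R.op_eq_integral_of_nonneg ⟨_, hn⟩ (fun y => le_max_right _ _) x
  have he' : f.1 = fun y => max (f.1 y) 0 - max (-f.1 y) 0 := congrArg Subtype.val he
  constructor
  · rw [he']; exact i1.sub i2
  · rw [he, map_sub, Pi.sub_apply, e1, e2, ← integral_sub i1 i2]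
    rfl

lemma apply_eq_integral (f : X → ℝ) (x : X) : R.apply f x = ∫ y, f y ∂(R.kernel x) := by
  unfold apply
  split_ifs with h
  · exact (R.op_eq_integral ⟨f, h⟩ x).2
  · rfl

/-- The measure `A ↦ R(χ_A)(x)` is carried by the fiber `σ⁻¹(x)`. -/
lemma ae_kernel [StandardBorelSpace X] (x : X) :
    ∀ᵐ y ∂(R.kernel x), R.σ y = x := by
  have hS : MeasurableSet (R.σ ⁻¹' {x}ᶜ) := R.measurable_σ (measurableSet_singleton x).compl
  have h0 : R.kernel x (R.σ ⁻¹' {x}ᶜ) = 0 := by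
    rw [R.kernel_apply x hS, opInd]
    have he : (R.σ ⁻¹' {x}ᶜ).indicator (fun _ => (1 : ℝ)) =
        fun y => ({x}ᶜ : Set X).indicator (fun _ => (1 : ℝ)) (R.σ y) * 1 := by
      ext y
      by_cases hy : R.σ y = x <;> simp [hy]
    have h1 : R.op ⟨_, R.indicator_mem hS⟩ x = 0 := by
      have := R.pull_out (({x}ᶜ : Set X).indicator fun _ => 1) ⟨_, R.one_mem⟩
        (measurable_const.indicator (measurableSet_singleton x).compl)
        (he ▸ R.indicator_mem hS) x
      rw [Set.indicator_of_notMem (by simp), zero_mul] at this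
      rw [← this]
      exact congrFun (R.op_congr he _ _) x
    rw [h1, ENNReal.ofReal_zero]
  exact h0

variable {R}

lemma Normalized.isMarkovKernel (hR : R.Normalized) : IsMarkovKernel R.kernel := by
  refine ⟨fun x => ⟨?_⟩⟩
  rw [R.kernel_apply x .univ, opInd]
  have : R.op ⟨_, R.indicator_mem .univ⟩ x = 1 :=
    (congrFun (R.op_congr (Set.indicator_univ _) _ R.one_mem) x).trans (hR x)
  rw [this, ENNReal.ofReal_one]

lemma measurable_apply (hR : R.Normalized) {f : X → ℝ} (hf : Measurable f) :
    Measurable (R.apply f) := by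
  have h : R.apply f = fun x => ∫ y, f y ∂(R.kernel x) := funext (R.apply_eq_integral f)
  have := hR.isMarkovKernel
  rw [h]
  exact (hf.stronglyMeasurable.integral_kernel).measurable

lemma ae_act_iff {μ : Measure X} {P : X → Prop} (hP : MeasurableSet {x | P x}) :
    (∀ᵐ y ∂(R.act μ), P y) ↔ ∀ᵐ x ∂μ, ∀ᵐ y ∂(R.kernel x), P y := by
  change R.act μ {x | P x}ᶜ = 0 ↔ _
  rw [act, Measure.bind_apply hP.compl R.kernel.aemeasurable,
    lintegral_eq_zero_iff (Kernel.measurable_coe _ hP.compl)]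
  rfl

lemma lintegral_act (μ : Measure X) {f : X → ℝ≥0∞} (hf : Measurable f) :
    ∫⁻ y, f y ∂(R.act μ) = ∫⁻ x, ∫⁻ y, f y ∂(R.kernel x) ∂μ :=
  Measure.lintegral_bind R.kernel.aemeasurable hf.aemeasurable

/-- `(μR) ∘ σ⁻¹ = μ` for a normalized operator. -/
lemma map_act (hR : R.Normalized) [StandardBorelSpace X] (μ : Measure X) :
    (R.act μ).map R.σ = μ := by
  have := hR.isMarkovKernel
  ext A hA
  rw [Measure.map_apply R.measurable_σ hA, act,
    Measure.bind_apply (R.measurable_σ hA) R.kernel.aemeasurable]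
  have : ∀ x, R.kernel x (R.σ ⁻¹' A) = A.indicator 1 x := fun x => by
    by_cases hx : x ∈ A
    · rw [Set.indicator_of_mem hx, Pi.one_apply, prob_compl_eq_zero_iff (R.measurable_σ hA) |>.1]
      refine measure_mono_null (fun y hy => ?_) (R.ae_kernel x)
      intro (h : R.σ y = x)
      exact hy (by simpa [h] using hx)
    · rw [Set.indicator_of_notMem hx]
      refine measure_mono_null (fun y hy => ?_) (R.ae_kernel x)
      intro (h : R.σ y = x)
      exact hx (by simpa [h] using hy)
  simp only [this]
  rw [lintegral_indicator_one hA]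

lemma sigmaFinite_act (hR : R.Normalized) [StandardBorelSpace X] (μ : Measure X) [SigmaFinite μ] :
    SigmaFinite (R.act μ) :=
  SigmaFinite.of_map _ R.measurable_σ.aemeasurable (by rw [map_act hR]; infer_instance)

lemma isProbabilityMeasure_act (hR : R.Normalized) (μ : Measure X) [IsProbabilityMeasure μ] :
    IsProbabilityMeasure (R.act μ) := by
  have := hR.isMarkovKernel
  unfold act
  infer_instance

lemma measurePreserving (hR : R.Normalized) [StandardBorelSpace X] (μ : Measure X) :
    MeasurePreserving R.σ (R.act μ) μ := ⟨R.measurable_σ, map_act hR μ⟩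

lemma act_mono {μ ν : Measure X} (h : μ ≪ ν) : R.act μ ≪ R.act ν := by
  refine Measure.AbsolutelyContinuous.mk fun A hA h0 => ?_
  rw [act, Measure.bind_apply hA R.kernel.aemeasurable,
    lintegral_eq_zero_iff (Kernel.measurable_coe _ hA)] at h0 ⊢
  exact h.ae_le h0

lemma act_withDensity [StandardBorelSpace X] (ρ : Measure X) {φ : X → ℝ≥0∞}
    (hφ : Measurable φ) :
    R.act (ρ.withDensity φ) = (R.act ρ).withDensity (fun y => φ (R.σ y)) := by
  ext A hA
  rw [withDensity_apply _ hA, ← lintegral_indicator hA,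
    lintegral_act _ (Measurable.indicator (f := fun y => φ (R.σ y)) (hφ.comp R.measurable_σ) hA), act,
    Measure.bind_apply hA R.kernel.aemeasurable,
    lintegral_withDensity_eq_lintegral_mul _ hφ (Kernel.measurable_coe _ hA)]
  refine lintegral_congr fun x => ?_
  rw [Pi.mul_apply, lintegral_indicator hA]
  have : ∀ᵐ y ∂((R.kernel x).restrict A), φ (R.σ y) = φ x := by
    refine ae_restrict_of_ae ?_
    filter_upwards [R.ae_kernel x] with y hy
    rw [hy]
  rw [lintegral_congr_ae this, lintegral_const, Measure.restrict_apply_univ]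

lemma rnDeriv_act (hR : R.Normalized) [StandardBorelSpace X] {μ ρ : Measure X} [SigmaFinite μ]
    [SigmaFinite ρ] (h : μ ≪ ρ) :
    (R.act μ).rnDeriv (R.act ρ) =ᵐ[R.act ρ] fun y => μ.rnDeriv ρ (R.σ y) := by
  have := sigmaFinite_act hR ρ
  conv_lhs => rw [← Measure.withDensity_rnDeriv_eq μ ρ h,
    act_withDensity ρ (Measure.measurable_rnDeriv _ _)]
  exact Measure.rnDeriv_withDensity _ ((Measure.measurable_rnDeriv _ _).comp R.measurable_σ)

/-- The function `R(f)` is in `L²(ν)` if `f` is in `L²(νR)`. -/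
lemma memLp_apply (hR : R.Normalized) (ν : Measure X) {f : X → ℝ} (hf : Measurable f) (h2 : MemLp f 2 (R.act ν)) :
    MemLp (R.apply f) 2 ν := by
  have := hR.isMarkovKernel
  refine ⟨(measurable_apply hR hf).aestronglyMeasurable, ?_⟩
  have h3 := h2.2
  rw [eLpNorm_lt_top_iff_lintegral_rpow_enorm_lt_top two_ne_zero ENNReal.ofNat_ne_top] at h3 ⊢
  rw [lintegral_act _ (by fun_prop)] at h3
  refine lt_of_le_of_lt (lintegral_mono fun x => ?_) h3
  rw [R.apply_eq_integral]
  have h4 : ‖∫ y, f y ∂(R.kernel x)‖ₑ ≤ eLpNorm f 2 (R.kernel x) :=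
    (enorm_integral_le_lintegral_enorm f).trans (by
      rw [← eLpNorm_one_eq_lintegral_enorm]
      exact eLpNorm_le_eLpNorm_of_exponent_le one_le_two hf.aestronglyMeasurable)
  refine (ENNReal.rpow_le_rpow h4 (by norm_num)).trans_eq ?_
  rw [eLpNorm_eq_lintegral_rpow_enorm_toReal two_ne_zero ENNReal.ofNat_ne_top, ← ENNReal.rpow_mul]
  norm_num

section Operators

variable [StandardBorelSpace X] (hR : R.Normalized)

/-- The map `(f, μ) ↦ (f ∘ σ, μR)` on pairs. -/
noncomputable def shatPair (p : SqrtPair X) : SqrtPair X where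
  measure := R.act p.measure
  fn := fun x => p.fn (R.σ x)
  sigmaFinite := sigmaFinite_act hR _
  measurable_fn := p.measurable_fn.comp R.measurable_σ
  memLp := p.memLp.comp_measurePreserving (measurePreserving hR _)

lemma density_shatPair (p : SqrtPair X) {ρ : Measure X} [SigmaFinite ρ] (h : p.measure ≪ ρ) :
    (shatPair hR p).density (R.act ρ) =ᵐ[R.act ρ] fun y => p.density ρ (R.σ y) := by
  filter_upwards [rnDeriv_act hR h] with y hy
  simp only [SqrtPair.density, shatPair]
  rw [hy]

lemma shatPair_equivalent {p q : SqrtPair X} (h : p.Equivalent q) :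
    (shatPair hR p).Equivalent (shatPair hR q) := by
  obtain ⟨ρ, hρ, hp, hq, he⟩ := h
  refine ⟨R.act ρ, sigmaFinite_act hR ρ, act_mono hp, act_mono hq, ?_⟩
  filter_upwards [density_shatPair hR p hp, density_shatPair hR q hq,
    (measurePreserving hR ρ).quasiMeasurePreserving.ae he] with y h1 h2 h3
  rw [h1, h2, h3]

/-- The operator `Ŝ(f √dμ) = (f ∘ σ) √d(μR)` on `ℋ(X)`. -/
noncomputable def shat : UniversalHilbert X → UniversalHilbert X :=
  Quotient.map (shatPair hR) fun _ _ h => shatPair_equivalent hR h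

/-- The closed subspace `ℋ_{K₁}` of `ℋ(X)` spanned by the subspaces `ℋ(μ)`, `μ ∈ K₁`. -/
noncomputable def spanK₁ (R : TransferOperator X) : Submodule ℝ (UniversalHilbert X) :=
  (Submodule.span ℝ {v | ∃ (μ : Measure X) (_ : SigmaFinite μ), μ ∈ R.K₁ ∧
    v ∈ UniversalHilbert.subspace μ}).topologicalClosure

/-- The vectors of `ℋ(νR)`, with `ν` running over the probability measures. -/
def vecK₁ (R : TransferOperator X) : Set (UniversalHilbert X) :=
  {v | ∃ (ν : Measure X) (_ : IsProbabilityMeasure ν) (_ : SigmaFinite (R.act ν)),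
    v ∈ UniversalHilbert.subspace (R.act ν)}

lemma vecK₁_mem_common (hR : R.Normalized) {v : ℕ → UniversalHilbert X} (hv : ∀ n, v n ∈ R.vecK₁) :
    ∃ (ν : Measure X) (_ : IsProbabilityMeasure ν) (_ : SigmaFinite (R.act ν)),
      ∀ n, v n ∈ UniversalHilbert.subspace (R.act ν) := by
  choose ν hν hs hv using hv
  have : NeZero (Measure.sum ν) := ⟨fun h => by
    have h1 := Measure.le_sum ν 0
    rw [h] at h1
    have h2 := h1 Set.univ
    simp at h2⟩
  have hS := sigmaFinite_act hR (Measure.sum ν).toFinite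
  exact ⟨(Measure.sum ν).toFinite, inferInstance, hS, fun n =>
    UniversalHilbert.subspace_mono (act_mono ((Measure.le_sum ν n).absolutelyContinuous.trans
      (absolutelyContinuous_toFinite _))) (hv n)⟩

lemma mem_spanK₁_iff (hR : R.Normalized) [Nonempty X] {v : UniversalHilbert X} : v ∈ R.spanK₁ ↔ v ∈ R.vecK₁ := by
  constructor
  · let V : Submodule ℝ (UniversalHilbert X) :=
      { carrier := R.vecK₁
        add_mem' := fun {a b} ha hb => by
          obtain ⟨ν, hν, hs, h⟩ := vecK₁_mem_common hR (v := fun n => if n = 0 then a else b)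
            (fun n => by split_ifs <;> assumption)
          exact ⟨ν, hν, hs, add_mem (by simpa using h 0) (by simpa using h 1)⟩
        zero_mem' := by
          obtain ⟨x⟩ := ‹Nonempty X›
          exact ⟨Measure.dirac x, inferInstance, sigmaFinite_act hR _, zero_mem _⟩
        smul_mem' := fun c a ⟨ν, hν, hs, h⟩ => ⟨ν, hν, hs, Submodule.smul_mem _ c h⟩ }
    have hV : IsClosed (V : Set (UniversalHilbert X)) := by
      refine IsSeqClosed.isClosed fun u a hu ha => ?_
      obtain ⟨ν, hν, hs, h⟩ := vecK₁_mem_common hR hu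
      exact ⟨ν, hν, hs,
        (UniversalHilbert.isComplete_subspace _).isClosed.mem_of_tendsto ha (.of_forall h)⟩
    intro hv
    refine Submodule.topologicalClosure_minimal _ (Submodule.span_le.2 ?_) hV hv
    rintro w ⟨μ, hμ, ⟨ν, hν, rfl⟩, hw⟩
    exact ⟨ν, hν, hμ, hw⟩
  · rintro ⟨ν, hν, hs, hv⟩
    exact Submodule.le_topologicalClosure _
      (Submodule.subset_span ⟨R.act ν, hs, ⟨ν, hν, rfl⟩, hv⟩)

/-- The vector `R(f) √d(μ ∘ σ⁻¹)`, for `μ ∈ K₁` and `f ∈ L²(μ)`. -/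
noncomputable def rhatVec {μ : Measure X} (hμ : μ ∈ R.K₁) (f : X → ℝ) (hf : Measurable f)
    (h2 : MemLp f 2 μ) : UniversalHilbert X :=
  UniversalHilbert.mk
    { measure := μ.map R.σ
      fn := R.apply f
      sigmaFinite := by
        obtain ⟨ν, hν, rfl⟩ := hμ
        rw [map_act hR]; infer_instance
      measurable_fn := measurable_apply hR hf
      memLp := by
        obtain ⟨ν, hν, rfl⟩ := hμ
        rw [map_act hR]; exact memLp_apply hR ν hf h2 }

lemma rhatVec_congr {μ μ' : Measure X} (hμ : μ ∈ R.K₁) (hμ' : μ' ∈ R.K₁) [SigmaFinite μ]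
    [SigmaFinite μ'] {f f' : X → ℝ} {hf : Measurable f} {h2 : MemLp f 2 μ}
    {hf' : Measurable f'} {h2' : MemLp f' 2 μ'}
    (h : UniversalHilbert.vec μ f hf h2 = UniversalHilbert.vec μ' f' hf' h2') :
    rhatVec hR hμ f hf h2 = rhatVec hR hμ' f' hf' h2' := by
  obtain ⟨ν, hν, rfl⟩ := id hμ
  obtain ⟨ν', hν', rfl⟩ := id hμ'
  have hτ : ν ≪ ν + ν' := Measure.AbsolutelyContinuous.rfl.add_right _
  have hτ' : ν' ≪ ν + ν' := Measure.AbsolutelyContinuous.rfl.add_right' _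
  have := sigmaFinite_act hR (ν + ν')
  have key := UniversalHilbert.mk_eq_iff_density.1 h (R.act (ν + ν')) this
  have h3 : ∀ᵐ y ∂(R.act (ν + ν')),
      f y * Real.sqrt (ν.rnDeriv (ν + ν') (R.σ y)).toReal =
        f' y * Real.sqrt (ν'.rnDeriv (ν + ν') (R.σ y)).toReal := by
    filter_upwards [key, rnDeriv_act hR hτ, rnDeriv_act hR hτ'] with y h1 h2 h3
    simp only [SqrtPair.density] at h1
    rwa [h2, h3] at h1
  have hm : ∀ κ : Measure X, Measurable fun y =>
      Real.sqrt (κ.rnDeriv (ν + ν') (R.σ y)).toReal := fun κ =>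
    Real.continuous_sqrt.measurable.comp
      (((Measure.measurable_rnDeriv _ _).comp R.measurable_σ).ennreal_toReal)
  replace h3 := (ae_act_iff (measurableSet_eq_fun (hf.mul (hm ν)) (hf'.mul (hm ν')))).1 h3
  refine UniversalHilbert.mk_eq_iff.2 ⟨ν + ν', inferInstance, ?_, ?_, ?_⟩
  · simpa only [map_act hR] using hτ
  · simpa only [map_act hR] using hτ'
  · filter_upwards [h3] with x hx
    simp only [SqrtPair.density, map_act hR, apply_eq_integral]
    rw [← integral_mul_const, ← integral_mul_const]
    refine integral_congr_ae ?_
    filter_upwards [hx, R.ae_kernel x] with y h4 h5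
    simp only [Pi.mul_apply, h5] at h4
    exact h4

/-- The defining relation of `R̂`: if `v = f √dμ + u` with `μ ∈ K₁` and `u ⟂ ℋ_{K₁}`, then
`R̂ v = R(f) √d(μ ∘ σ⁻¹)`. -/
def IsRhat (v w : UniversalHilbert X) : Prop :=
  ∃ (μ : Measure X) (_ : SigmaFinite μ) (hμ : μ ∈ R.K₁) (f : X → ℝ) (hf : Measurable f)
    (h2 : MemLp f 2 μ) (u : UniversalHilbert X), u ∈ R.spanK₁ᗮ ∧
    v = UniversalHilbert.vec μ f hf h2 + u ∧ w = rhatVec hR hμ f hf h2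

theorem existsUnique_isRhat [Nonempty X] (v : UniversalHilbert X) : ∃! w, IsRhat hR v w := by
  have hcl : IsClosed (R.spanK₁ : Set (UniversalHilbert X)) :=
    Submodule.isClosed_topologicalClosure _
  have : CompleteSpace R.spanK₁ := hcl.completeSpace_coe
  obtain ⟨y, hy, u, hu, rfl⟩ := R.spanK₁.exists_add_mem_mem_orthogonal v
  obtain ⟨ν, hν, hs, hy'⟩ := (mem_spanK₁_iff hR).1 hy
  obtain ⟨f, hf, h2, rfl⟩ := UniversalHilbert.mem_subspace_iff.1 hy'
  refine ⟨rhatVec hR ⟨ν, hν, rfl⟩ f hf h2, ⟨_, hs, ⟨ν, hν, rfl⟩, f, hf, h2, u, hu, rfl, rfl⟩, ?_⟩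
  rintro w ⟨μ, hμs, hμ, g, hg, hg2, u', hu', h, rfl⟩
  refine rhatVec_congr hR hμ _ ?_
  have hgm : UniversalHilbert.vec μ g hg hg2 ∈ R.spanK₁ :=
    Submodule.le_topologicalClosure _
      (Submodule.subset_span ⟨μ, hμs, hμ, UniversalHilbert.vec_mem_subspace μ hg hg2⟩)
  have h3 : UniversalHilbert.vec μ g hg hg2 - UniversalHilbert.vec (R.act ν) f hf h2 = u - u' := by
    rw [sub_eq_sub_iff_add_eq_add, ← h, add_comm]
  have h4 := Submodule.sub_mem _ hgm hy
  have h5 : UniversalHilbert.vec μ g hg hg2 - UniversalHilbert.vec (R.act ν) f hf h2 ∈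
      R.spanK₁ᗮ := h3 ▸ Submodule.sub_mem _ hu hu'
  exact sub_eq_zero.1 (inner_self_eq_zero.1 (Submodule.inner_right_of_mem_orthogonal h4 h5))

/-- The operator `R̂` on `ℋ(X)`: it sends `f √dμ` with `μ ∈ K₁` to `R(f) √d(μ ∘ σ⁻¹)`, and it
vanishes on the orthogonal complement of `ℋ_{K₁}`. -/
noncomputable def rhat [Nonempty X] (v : UniversalHilbert X) : UniversalHilbert X :=
  (existsUnique_isRhat hR v).choose

lemma rhat_vec [Nonempty X] {μ : Measure X} [SigmaFinite μ] (hμ : μ ∈ R.K₁) {f : X → ℝ}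
    (hf : Measurable f) (h2 : MemLp f 2 μ) :
    rhat hR (UniversalHilbert.vec μ f hf h2) = rhatVec hR hμ f hf h2 :=
  ((existsUnique_isRhat hR _).choose_spec.2 _
    ⟨μ, inferInstance, hμ, f, hf, h2, 0, zero_mem _, (add_zero _).symm, rfl⟩).symm

lemma rhat_orthogonal [Nonempty X] {u : UniversalHilbert X} (hu : u ∈ R.spanK₁ᗮ) :
    rhat hR u = 0 := by
  obtain ⟨x⟩ := id ‹Nonempty X›
  have := sigmaFinite_act hR (Measure.dirac x)
  have h0 : ∀ (μ : Measure X) [SigmaFinite μ],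
      UniversalHilbert.vec μ (fun _ => 0) measurable_const MemLp.zero' = 0 := fun μ _ =>
    UniversalHilbert.mk_eq_iff_density.2 fun τ _ => .of_forall fun y => by
      simp [SqrtPair.density, SqrtPair.zero]
  refine ((existsUnique_isRhat hR _).choose_spec.2 _
    ⟨_, this, ⟨Measure.dirac x, inferInstance, rfl⟩, fun _ => 0, measurable_const, MemLp.zero', u,
      hu, by rw [h0, zero_add], ?_⟩).symm
  refine UniversalHilbert.mk_eq_iff_density.2 fun τ _ => .of_forall fun y => ?_
  simp [SqrtPair.density, SqrtPair.zero, apply_eq_integral]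

end Operators

/-- The conditional expectation `𝔼_μ(f | σ⁻¹(𝓑))`. -/
noncomputable def condExpσ (R : TransferOperator X) (μ : Measure X) (f : X → ℝ) : X → ℝ :=
  μ[f | MeasurableSpace.comap R.σ inferInstance]

lemma measurable_condExpσ (R : TransferOperator X) (μ : Measure X) (f : X → ℝ) :
    Measurable (R.condExpσ μ f) :=
  (stronglyMeasurable_condExp.mono R.measurable_σ.comap_le).measurable

lemma memLp_condExpσ (R : TransferOperator X) {μ : Measure X} {f : X → ℝ} (h : MemLp f 2 μ) :
    MemLp (R.condExpσ μ f) 2 μ := h.condExp one_le_two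

end TransferOperator

/-! Write κ_x for `R.kernel x`. Since `R` is normalized and satisfies the pull-out property, κ_x is
a probability measure carried by the fiber σ⁻¹(x). Everything rests on this: pushing νR forward by σ
gives back ν (`map_act`), and a density that depends only on σ y passes through the action, (φν)R =
(φ ∘ σ)(νR) (`act_withDensity`).

The first fact makes ν ↦ νR injective with left inverse the pushforward by σ, so the only candidate
for ν in μ = νR is μ ∘ σ⁻¹. This is (1) ↔ (2). Statement (2) says that μ disintegrates along σ with
conditional measures κ_x, and R(f)(x) = ∫ f dκ_x is then the fiber average of f. Hence R(f) ∘ σ is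
the conditional expectation, which is (3); integrating (3) for indicators returns (2).

Under (2) the operators compute directly: R̂ sends f √dμ to R(f) √d(μ ∘ σ⁻¹), and Ŝ sends this to
(R(f) ∘ σ) √d((μ ∘ σ⁻¹)R) = 𝔼(f | σ⁻¹(𝓑)) √dμ, which gives (4).

The way back from (4) needs only f = 1: it places √dμ in the range of Ŝ, so √dμ = (g ∘ σ) √d(νR) for
some sigma-finite ν and g ∈ L²(ν). Squaring gives μ = (g² ∘ σ)(νR) = (g²ν)R by the second fact, and
g²ν = μ ∘ σ⁻¹ is automatically a probability measure. Thus no information on R̂ off ℋ_{K₁} is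
required. -/

namespace UniversalHilbert

/-! ### Recovering a measure from its square-root vector. -/

variable {X : Type*} [MeasurableSpace X]

/-- If `√dμ = g √dν`, then `μ` has the density `g²` with respect to `ν`. -/
lemma eq_withDensity_of_vec_one_eq {μ ν : Measure X} [SigmaFinite μ] [SigmaFinite ν] {g : X → ℝ}
    {h1 : MemLp (fun _ : X => (1 : ℝ)) 2 μ} {hg : Measurable g} {hg2 : MemLp g 2 ν}
    (h : vec μ (fun _ => 1) measurable_const h1 = vec ν g hg hg2) :
    μ = ν.withDensity fun x => ENNReal.ofReal (g x ^ 2) := by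
  have hμ : μ ≪ μ + ν := Measure.AbsolutelyContinuous.rfl.add_right _
  have hν : ν ≪ μ + ν := Measure.AbsolutelyContinuous.rfl.add_right' _
  have hm : Measurable fun x => ENNReal.ofReal (g x ^ 2) := (hg.pow_const 2).ennreal_ofReal
  -- Neither measure is known in advance to dominate the other, so both are compared through their
  -- densities with respect to μ + ν.
  have key := mk_eq_iff_density.1 h (μ + ν) inferInstance
  conv_lhs => rw [← Measure.withDensity_rnDeriv_eq μ (μ + ν) hμ]
  conv_rhs => rw [← Measure.withDensity_rnDeriv_eq ν (μ + ν) hν]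
  rw [← withDensity_mul _ (Measure.measurable_rnDeriv _ _) hm]
  refine withDensity_congr_ae ?_
  filter_upwards [key, Measure.rnDeriv_lt_top μ (μ + ν), Measure.rnDeriv_lt_top ν (μ + ν)]
    with x hx hx1 hx2
  simp only [SqrtPair.density, one_mul] at hx
  -- Squaring removes the roots and gives dμ/dρ = g² dν/dρ for ρ = μ + ν, so the sign of g is
  -- irrelevant. The identity holds between real numbers; it lifts to `ℝ≥0∞` because both
  -- derivatives are finite almost everywhere.
  replace hx := congrArg (fun t : ℝ => t ^ 2) hx
  simp only [mul_pow, Real.sq_sqrt ENNReal.toReal_nonneg] at hx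
  rw [Pi.mul_apply, ← ENNReal.ofReal_toReal hx1.ne, hx, ENNReal.ofReal_mul (sq_nonneg _),
    ENNReal.ofReal_toReal hx2.ne, mul_comm]

end UniversalHilbert

namespace TransferOperator

/-! ### Membership in K₁ and the range of Ŝ. -/

variable {X : Type*} [MeasurableSpace X] {R : TransferOperator X}

/-- Pushing νR forward by σ returns ν (`map_act`), so μ ∘ σ⁻¹ is the only measure that can produce
μ. -/
lemma mem_K₁_iff [StandardBorelSpace X] (hR : R.Normalized) {μ : Measure X}
    [IsProbabilityMeasure μ] : μ ∈ R.K₁ ↔ R.act (μ.map R.σ) = μ := by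
  constructor
  · rintro ⟨ν, -, rfl⟩
    rw [map_act hR]
  · exact fun h => ⟨μ.map R.σ, Measure.isProbabilityMeasure_map R.measurable_σ.aemeasurable, h.symm⟩

/-- A vector `√dμ` in the range of `Ŝ` comes from a measure `μ ∈ K₁`. -/
lemma mem_K₁_of_shat_eq [StandardBorelSpace X] (hR : R.Normalized) {μ : Measure X}
    [IsProbabilityMeasure μ] {h1 : MemLp (fun _ : X => (1 : ℝ)) 2 μ} {w : UniversalHilbert X}
    (h : shat hR w = UniversalHilbert.vec μ (fun _ => 1) measurable_const h1) : μ ∈ R.K₁ := by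
  obtain ⟨ν, hν, g, hg, hg2, rfl⟩ := UniversalHilbert.exists_vec w
  have := sigmaFinite_act hR ν
  have h2 := UniversalHilbert.eq_withDensity_of_vec_one_eq (ν := R.act ν) (g := fun x => g (R.σ x))
    (hg := hg.comp R.measurable_σ)
    (hg2 := hg2.comp_measurePreserving (measurePreserving hR ν)) h.symm
  -- The density (g ∘ σ)² depends on σ y alone, so it can be moved inside the action: μ = (g²ν)R.
  rw [← act_withDensity ν (φ := fun x => ENNReal.ofReal (g x ^ 2))
    (hg.pow_const 2).ennreal_ofReal] at h2
  rw [mem_K₁_iff hR]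
  -- The pushforward of (g²ν)R by σ is g²ν, so applying the action again returns μ. Going through
  -- the criterion avoids a separate check that g²ν has total mass 1.
  conv_lhs => rw [h2, map_act hR]
  exact h2.symm

/-! ### Integration against νR. -/

lemma integrable_kernel_of_integrable_act {ν : Measure X} {f : X → ℝ}
    (hf : Integrable f (R.act ν)) : ∀ᵐ x ∂ν, Integrable f (R.kernel x) :=
  Measure.ae_integrable_of_integrable_comp hf

/-- The duality between the action on functions and the action on measures. It covers every
νR-integrable f, including those outside the domain of `R`, because `apply` is always integration
against the kernel. -/
lemma integral_apply (hR : R.Normalized) {ν : Measure X} [SFinite ν] {f : X → ℝ}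
    (hf : Integrable f (R.act ν)) : ∫ x, R.apply f x ∂ν = ∫ y, f y ∂(R.act ν) := by
  have := hR.isMarkovKernel
  simp only [apply_eq_integral]
  -- A measure is a constant kernel on a one-point space, which turns νR into a composition of
  -- kernels.
  exact (Kernel.integral_comp (κ := Kernel.const Unit ν) (η := R.kernel) (a := ()) hf).symm

/-! ### Fiber averages and the conditional expectation. -/

/-- If `(μ ∘ σ⁻¹) R = μ`, then `f ↦ R(f) ∘ σ` is the conditional expectation on `σ⁻¹(𝓑)`. -/
lemma apply_comp_ae_eq_condExpσ [StandardBorelSpace X] (hR : R.Normalized) {μ : Measure X}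
    [IsProbabilityMeasure μ] (h : R.act (μ.map R.σ) = μ) {f : X → ℝ} (hf : Measurable f)
    (h2 : MemLp f 2 μ) : (fun x => R.apply f (R.σ x)) =ᵐ[μ] R.condExpσ μ f := by
  have hint : Integrable f μ := h2.integrable one_le_two
  have hp : IsProbabilityMeasure (μ.map R.σ) :=
    Measure.isProbabilityMeasure_map R.measurable_σ.aemeasurable
  have hm := measurable_apply hR hf
  -- The square of a fiber average is at most the fiber average of the square, so R(f) inherits
  -- square integrability from f. This secures the integrability that the characterization of
  -- conditional expectation demands.
  have hL : MemLp (R.apply f) 2 (μ.map R.σ) := memLp_apply hR _ hf (by rwa [h])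
  have hL' : Integrable (fun x => R.apply f (R.σ x)) μ :=
    (hL.integrable one_le_two).comp_measurable R.measurable_σ
  refine ae_eq_condExp_of_forall_setIntegral_eq R.measurable_σ.comap_le hint
    (fun _ _ _ => hL'.integrableOn) ?_
    (hm.comp (comap_measurable R.σ)).stronglyMeasurable.aestronglyMeasurable
  rintro _ ⟨B, hB, rfl⟩ -
  have hi : Integrable ((R.σ ⁻¹' B).indicator f) (R.act (μ.map R.σ)) := by
    rw [h]; exact hint.indicator (R.measurable_σ hB)
  rw [← integral_indicator (R.measurable_σ hB) (f := f)]
  -- Both sides become integrals over μ ∘ σ⁻¹: this one of R(χ f), with χ the indicator of σ⁻¹(B),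
  -- the other of the indicator of B times R(f).
  conv_rhs => rw [← h, ← integral_apply hR hi]
  rw [← setIntegral_map hB hm.aestronglyMeasurable R.measurable_σ.aemeasurable,
    ← integral_indicator hB]
  -- What remains is a pull-out identity, checked at each x. The field `pull_out` covers only the
  -- domain, and f may lie outside it; instead, κ_x lives on σ⁻¹(x), so the indicator of σ⁻¹(B) is
  -- κ_x-almost everywhere constant, equal to 1 or 0 according to whether x ∈ B.
  refine integral_congr_ae (.of_forall fun x => ?_)
  simp only [apply_eq_integral]
  by_cases hx : x ∈ B
  · rw [Set.indicator_of_mem hx, apply_eq_integral]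
    refine integral_congr_ae ?_
    filter_upwards [R.ae_kernel x] with y hy
    rw [Set.indicator_of_mem (by simpa [hy] using hx)]
  · rw [Set.indicator_of_notMem hx]
    refine (integral_eq_zero_of_ae ?_).symm
    filter_upwards [R.ae_kernel x] with y hy
    rw [Set.indicator_of_notMem (by simpa [hy] using hx), Pi.zero_apply]

/-- If `R(χ_A) ∘ σ` is the conditional expectation of `χ_A` for all `A`, then
`(μ ∘ σ⁻¹) R = μ`. -/
lemma act_map_eq_of_apply_comp_ae_eq [StandardBorelSpace X] (hR : R.Normalized) {μ : Measure X}
    [IsProbabilityMeasure μ]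
    (h : ∀ A, MeasurableSet A → (fun x => R.apply (A.indicator fun _ => 1) (R.σ x)) =ᵐ[μ]
      R.condExpσ μ (A.indicator fun _ => 1)) : R.act (μ.map R.σ) = μ := by
  have hp : IsProbabilityMeasure (μ.map R.σ) :=
    Measure.isProbabilityMeasure_map R.measurable_σ.aemeasurable
  have := isProbabilityMeasure_act hR (μ.map R.σ)
  ext A hA
  have hA1 : Measurable (A.indicator fun _ => (1 : ℝ)) := measurable_const.indicator hA
  -- Integrals over the whole space suffice: the conditional expectation integrates to μ(A), while
  -- R(χ_A) ∘ σ integrates to ((μ ∘ σ⁻¹)R)(A).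
  have h1 := integral_congr_ae (h A hA)
  rw [condExpσ, integral_condExp R.measurable_σ.comap_le, ← integral_map
    R.measurable_σ.aemeasurable (measurable_apply hR hA1).aestronglyMeasurable,
    integral_apply hR ((integrable_const 1).indicator hA), integral_indicator_const _ hA,
    integral_indicator_const _ hA, smul_eq_mul, smul_eq_mul, mul_one, mul_one] at h1
  exact (measureReal_eq_measureReal_iff).1 h1

/-- If `(μ ∘ σ⁻¹) R = μ`, then `Ŝ R̂` acts on `ℋ(μ)` as the conditional expectation. -/
lemma shat_rhat_vec [StandardBorelSpace X] [Nonempty X] (hR : R.Normalized) {μ : Measure X}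
    [IsProbabilityMeasure μ] (h : R.act (μ.map R.σ) = μ) {f : X → ℝ} (hf : Measurable f)
    (h2 : MemLp f 2 μ) :
    shat hR (rhat hR (UniversalHilbert.vec μ f hf h2)) =
      UniversalHilbert.vec μ (R.condExpσ μ f) (R.measurable_condExpσ μ f)
        (R.memLp_condExpσ h2) := by
  rw [rhat_vec hR ((mem_K₁_iff hR).2 h)]
  -- By definition Ŝ produces the pair (R(f) ∘ σ, (μ ∘ σ⁻¹)R). The hypothesis `h` identifies its
  -- measure with μ, so the two vectors agree once their functions agree μ-almost everywhere.
  exact UniversalHilbert.mk_eq_iff.2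
    (SqrtPair.equivalent_of_ae (μ := μ) h rfl (apply_comp_ae_eq_condExpσ hR h hf h2))

end TransferOperator

/-! ### The equivalences. -/

theorem mainTheorem9 {X : Type*} [MeasurableSpace X] [StandardBorelSpace X] [Nonempty X]
    (R : TransferOperator X) (hR : R.Normalized) (μ : Measure X) [IsProbabilityMeasure μ] :
    List.TFAE [
      -- (1) `μ` belongs to `K₁ = M₁(X) R`
      μ ∈ R.K₁,
      -- (2) `(μ ∘ σ⁻¹) R = μ`
      R.act (μ.map R.σ) = μ,
      -- (3) `f ↦ R(f) ∘ σ` is defined on `L²(μ)` and is the conditional expectation on `σ⁻¹(𝓑)`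
      ∀ f : X → ℝ, Measurable f → MemLp f 2 μ →
        (∀ᵐ x ∂μ, Integrable f (R.kernel (R.σ x))) ∧
          (fun x => R.apply f (R.σ x)) =ᵐ[μ] R.condExpσ μ f,
      -- (4) `Ŝ R̂` leaves `ℋ(μ)` invariant and acts on it as the conditional expectation
      (∀ v ∈ UniversalHilbert.subspace μ,
        TransferOperator.shat hR (TransferOperator.rhat hR v) ∈ UniversalHilbert.subspace μ) ∧
      ∀ (f : X → ℝ) (hf : Measurable f) (h2 : MemLp f 2 μ),
        TransferOperator.shat hR (TransferOperator.rhat hR (UniversalHilbert.vec μ f hf h2)) =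
          UniversalHilbert.vec μ (R.condExpσ μ f) (R.measurable_condExpσ μ f)
            (R.memLp_condExpσ h2)] := by
  tfae_have 1 ↔ 2 := TransferOperator.mem_K₁_iff hR
  tfae_have 2 → 3 := fun h f hf h2 => by
    -- The integrability clause is separate because a divergent Bochner integral has the default
    -- value 0. As f is integrable for (μ ∘ σ⁻¹)R, it is κ_x-integrable for almost every x with
    -- respect to μ ∘ σ⁻¹, and this pulls back along σ.
    refine ⟨ae_of_ae_map R.measurable_σ.aemeasurable
      (TransferOperator.integrable_kernel_of_integrable_act ?_),
      TransferOperator.apply_comp_ae_eq_condExpσ hR h hf h2⟩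
    rw [h]
    exact h2.integrable one_le_two
  tfae_have 3 → 2 := fun h => TransferOperator.act_map_eq_of_apply_comp_ae_eq hR fun A hA =>
    (h _ (measurable_const.indicator hA) ((memLp_const 1).indicator hA)).2
  tfae_have 2 → 4 := fun h => by
    refine ⟨fun v hv => ?_, fun f hf h2 => TransferOperator.shat_rhat_vec hR h hf h2⟩
    obtain ⟨f, hf, h2, rfl⟩ := UniversalHilbert.mem_subspace_iff.1 hv
    rw [TransferOperator.shat_rhat_vec hR h]
    exact UniversalHilbert.vec_mem_subspace _ _ _
  tfae_have 4 → 1 := fun h => by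
    -- The constant 1 is its own conditional expectation, so √dμ is the image under Ŝ of the vector
    -- R̂(√dμ), whatever that vector is.
    refine TransferOperator.mem_K₁_of_shat_eq hR (h1 := memLp_const 1)
      ((h.2 (fun _ => 1) measurable_const (memLp_const 1)).trans (UniversalHilbert.vec_congr ?_))
    rw [TransferOperator.condExpσ, condExp_const R.measurable_σ.comap_le]
  tfae_finish
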